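/- Let $d \ge 0$ be an integer and $a, b > 0$. Let $\mathcal{M}(\mathbb{R}^d)$ be the set of finite positive Borel measures on $\mathbb{R}^d$, and let $\mathcal{M}^s(\mathbb{R}^d)$ be the vector space of finite signed Borel measures on $\mathbb{R}^d$, i.e. of differences of two elements of $\mathcal{M}(\mathbb{R}^d)$. For $\mu \in \mathcal{M}^s(\mathbb{R}^d)$ with Jordan decomposition $\mu = \mu^+ - \mu^-$, let $|\mu| = \mu^+(\mathbb{R}^d) + \mu^-(\mathbb{R}^d)$ denote its mass. For $\mu, \nu \in \mathcal{M}(\mathbb{R}^d)$ with $|\mu| = |\nu|$, let $$W_1(\mu,\nu) = \inf_{\pi} \int_{\mathbb{R}^d \times \mathbb{R}^d} |x-y| \, d\pi(x,y) \in [0,\infty],$$ where $\pi$ ranges over the positive measures on $\mathbb{R}^d \times \mathbb{R}^d$ with first marginal $\mu$ and second marginal $\nu$. For $\mu, \nu \in \mathcal{M}(\mathbb{R}^d)$, let $$W_1^{a,b}(\mu,\nu) = \inf \bigl\{ a\,(|\mu-\tilde\mu| + |\nu-\tilde\nu|) + b\, W_1(\tilde\mu,\tilde\nu) \;:\; \tilde\mu,\tilde\nu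 \in \mathcal{M}(\mathbb{R}^d),\ |\tilde\mu| = |\tilde\nu| \bigr\},$$ and for $\mu \in \mathcal{M}^s(\mathbb{R}^d)$ let $\|\mu\|^{a,b} = W_1^{a,b}(\mu^+,\mu^-)$. A sequence $(\mu_n)$ in $\mathcal{M}^s(\mathbb{R}^d)$ is called tight if for every $\varepsilon > 0$ there is a compact set $K \subset \mathbb{R}^d$ such that $\mu_n^+(\mathbb{R}^d \setminus K) < \varepsilon$ and $\mu_n^-(\mathbb{R}^d \setminus K) < \varepsilon$ for all $n$; it has uniformly bounded mass if $\sup_n |\mu_n| < \infty$. **Theorem.** (1) If $d \ge 1$, then $(\mathcal{M}^s(\mathbb{R}^d), \|\cdot\|^{a,b})$ is not complete: there is a sequence in $\mathcal{M}^s(\mathbb{R}^d)$ that is Cauchy for $\|\cdot\|^{a,b}$ but does not converge for $\|\cdot\|^{a,b}$ to any element of $\mathcal{M}^s(\mathbb{R}^d)$. (2) Every sequence $(\mu_n)$ in $\mathcal{M}^s(\mathbb{R}^d)$ that is Cauchy for $\|\cdot\|^{a,b}$, tight, and of uniformly bounded mass converges for $\|\cdot\|^{a,b}$: there is $\mu \in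 \mathcal{M}^s(\mathbb{R}^d)$ with $\|\mu_n - \mu\|^{a,b} \to 0$. -/

import Mathlib

open MeasureTheory Filter Topology
open scoped ENNReal NNReal

/-- The total mass `|σ|` of a signed measure: the mass of the sum of the two parts of its Jordan
decomposition. -/
noncomputable def signedMass {d : ℕ} (σ : SignedMeasure (EuclideanSpace ℝ (Fin d))) : ℝ≥0∞ :=
  σ.totalVariation Set.univ

/-- The transference plans between two measures on `ℝ^d`: the measures on `ℝ^d × ℝ^d` whose
marginals are the two given measures. -/
def transferencePlans {d : ℕ} (μ ν : Measure (EuclideanSpace ℝ (Fin d))) :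
    Set (Measure (EuclideanSpace ℝ (Fin d) × EuclideanSpace ℝ (Fin d))) :=
  {π | π.map Prod.fst = μ ∧ π.map Prod.snd = ν}

/-- The Wasserstein distance `W₁` between two measures of the same mass, with values in `[0, ∞]`
(no first moment is required). -/
noncomputable def wasserstein1 {d : ℕ} (μ ν : Measure (EuclideanSpace ℝ (Fin d))) : ℝ≥0∞ :=
  ⨅ π ∈ transferencePlans μ ν, ∫⁻ z, edist z.1 z.2 ∂π

/-- The generalized Wasserstein distance `W₁^{a,b}` between two finite measures on `ℝ^d`: the
infimum of `a (|μ - μ'| + |ν - ν'|) + b W₁(μ', ν')` over all pairs of finite measures `μ'`, `ν'`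
of the same mass. -/
noncomputable def genWasserstein {d : ℕ} (a b : ℝ) (μ ν : Measure (EuclideanSpace ℝ (Fin d)))
    [IsFiniteMeasure μ] [IsFiniteMeasure ν] : ℝ≥0∞ :=
  ⨅ (μ' : FiniteMeasure (EuclideanSpace ℝ (Fin d)))
    (ν' : FiniteMeasure (EuclideanSpace ℝ (Fin d))) (_ : μ'.mass = ν'.mass),
    ENNReal.ofReal a *
        (signedMass (μ.toSignedMeasure - (μ' : Measure (EuclideanSpace ℝ (Fin d))).toSignedMeasure)
        + signedMass
            (ν.toSignedMeasure - (ν' : Measure (EuclideanSpace ℝ (Fin d))).toSignedMeasure))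
      + ENNReal.ofReal b * wasserstein1 (μ' : Measure (EuclideanSpace ℝ (Fin d))) ν'

/-- The generalized Wasserstein distance is always finite (cancel all the mass). -/
theorem genWasserstein_ne_top {d : ℕ} (a b : ℝ) (μ ν : Measure (EuclideanSpace ℝ (Fin d)))
    [IsFiniteMeasure μ] [IsFiniteMeasure ν] : genWasserstein a b μ ν ≠ ∞ := by
  have hmass : ∀ σ : SignedMeasure (EuclideanSpace ℝ (Fin d)), signedMass σ ≠ ∞ := by
    intro σ
    simp only [signedMass, SignedMeasure.totalVariation, Measure.add_apply]
    exact ENNReal.add_ne_top.2 ⟨measure_ne_top _ _, measure_ne_top _ _⟩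
  have hW : wasserstein1 (0 : Measure (EuclideanSpace ℝ (Fin d))) 0 = 0 := by
    refine le_antisymm ?_ bot_le
    refine (iInf₂_le (0 : Measure (EuclideanSpace ℝ (Fin d) × EuclideanSpace ℝ (Fin d)))
      ⟨by simp, by simp⟩).trans ?_
    simp
  refine ne_top_of_le_ne_top ?_ ((iInf_le _ 0).trans ((iInf_le _ 0).trans (iInf_le _ rfl)))
  refine ENNReal.add_ne_top.2 ⟨ENNReal.mul_ne_top ENNReal.ofReal_ne_top
    (ENNReal.add_ne_top.2 ⟨hmass _, hmass _⟩), ?_⟩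
  refine ENNReal.mul_ne_top ENNReal.ofReal_ne_top ?_
  simp [hW]

/-- The generalized Wasserstein norm `‖σ‖^{a,b} = W₁^{a,b}(σ⁺, σ⁻)` of a finite signed measure on
`ℝ^d`, through its Jordan decomposition. -/
noncomputable def genWassersteinNorm {d : ℕ} (a b : ℝ)
    (σ : SignedMeasure (EuclideanSpace ℝ (Fin d))) : ℝ :=
  (genWasserstein a b σ.toJordanDecomposition.posPart σ.toJordanDecomposition.negPart).toReal

/-- Cauchy sequences of signed measures for the norm `‖·‖^{a,b}`. -/
def IsGenWassersteinCauchy {d : ℕ} (a b : ℝ)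
    (μ : ℕ → SignedMeasure (EuclideanSpace ℝ (Fin d))) : Prop :=
  ∀ ε : ℝ, 0 < ε → ∃ N : ℕ, ∀ m ≥ N, ∀ n ≥ N, genWassersteinNorm a b (μ m - μ n) < ε

/-- Convergence of a sequence of signed measures for the norm `‖·‖^{a,b}`. -/
def GenWassersteinTendsto {d : ℕ} (a b : ℝ)
    (μ : ℕ → SignedMeasure (EuclideanSpace ℝ (Fin d)))
    (ν : SignedMeasure (EuclideanSpace ℝ (Fin d))) : Prop :=
  Tendsto (fun n => genWassersteinNorm a b (μ n - ν)) atTop (𝓝 0)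

/-- A sequence of signed measures is tight when the positive parts and the negative parts of the
Jordan decompositions are both tight. -/
def IsTightSignedSeq {d : ℕ} (μ : ℕ → SignedMeasure (EuclideanSpace ℝ (Fin d))) : Prop :=
  IsTightMeasureSet (Set.range fun n => (μ n).toJordanDecomposition.posPart) ∧
    IsTightMeasureSet (Set.range fun n => (μ n).toJordanDecomposition.negPart)

/-- A sequence of signed measures has uniformly bounded mass. -/
def HasBoundedMass {d : ℕ} (μ : ℕ → SignedMeasure (EuclideanSpace ℝ (Fin d))) : Prop :=
  ∃ C : ℝ≥0, ∀ n, signedMass (μ n) ≤ C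

/-! Everything rests on two estimates between the norm and weak convergence. Bounded Lipschitz
functions integrate continuously for the norm (`enorm_integral_sub_le_genWasserstein`, the easy half
of duality). Conversely, two families of positive measures with a common weak limit become close for
`genWasserstein` (`tendsto_genWasserstein_zero`): cut space into small cells, transport inside each
cell the mass both measures share there, cancel the rest.

Completeness: along a free ultrafilter the Jordan parts of `μ n` converge weakly to some `α`, `β`;
put `ν = α - β`. The Cauchy property upgrades this to convergence of bounded Lipschitz integrals
along the whole sequence. The Jordan parts of `μ n - ν` are again tight and of bounded mass, and
their weak limits along any ultrafilter have equal Lipschitz integrals, hence coincide. The second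
estimate then says that the norm tends to `0`. No triangle inequality for the norm is needed.

Incompleteness: dipoles of summable length, placed further and further away, have Cauchy partial
sums. Tents isolating one positive pole each would have integral `1` against a limit, while they
tend to `0` pointwise. -/

/-! ### Integration against signed measures and minimality of the Jordan decomposition. -/

section SignedMeasure

variable {X : Type*} [MeasurableSpace X]

theorem toSignedMeasure_sub_eq_sub_iff (μ ν μ' ν' : Measure X) [IsFiniteMeasure μ]
    [IsFiniteMeasure ν] [IsFiniteMeasure μ'] [IsFiniteMeasure ν'] :
    μ.toSignedMeasure - ν.toSignedMeasure = μ'.toSignedMeasure - ν'.toSignedMeasure ↔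
      μ + ν' = μ' + ν := by
  rw [sub_eq_sub_iff_add_eq_add, ← Measure.toSignedMeasure_add, ← Measure.toSignedMeasure_add,
    Measure.toSignedMeasure_eq_toSignedMeasure_iff]

/-- Cross-adding turns the hypothesis into an equality of positive measures. It frees
`signedIntegral` from the Jordan decomposition. -/
theorem integral_sub_eq_of_toSignedMeasure_sub_eq {μ ν μ' ν' : Measure X} [IsFiniteMeasure μ]
    [IsFiniteMeasure ν] [IsFiniteMeasure μ'] [IsFiniteMeasure ν']
    (h : μ.toSignedMeasure - ν.toSignedMeasure = μ'.toSignedMeasure - ν'.toSignedMeasure)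
    {f : X → ℝ} (hf : ∀ ρ : Measure X, IsFiniteMeasure ρ → Integrable f ρ) :
    ∫ x, f x ∂μ - ∫ x, f x ∂ν = ∫ x, f x ∂μ' - ∫ x, f x ∂ν' := by
  rw [toSignedMeasure_sub_eq_sub_iff] at h
  rw [sub_eq_sub_iff_add_eq_add, ← integral_add_measure (hf _ inferInstance) (hf _ inferInstance),
    ← integral_add_measure (hf _ inferInstance) (hf _ inferInstance), h]

/-- The integral of a function against a signed measure. -/
noncomputable def signedIntegral (f : X → ℝ) (σ : SignedMeasure X) : ℝ :=
  ∫ x, f x ∂σ.toJordanDecomposition.posPart - ∫ x, f x ∂σ.toJordanDecomposition.negPart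

theorem posPart_toSignedMeasure_sub_negPart (σ : SignedMeasure X) :
    σ.toJordanDecomposition.posPart.toSignedMeasure -
      σ.toJordanDecomposition.negPart.toSignedMeasure = σ :=
  σ.toSignedMeasure_toJordanDecomposition

theorem signedIntegral_toSignedMeasure_sub (μ ν : Measure X) [IsFiniteMeasure μ]
    [IsFiniteMeasure ν] {f : X → ℝ}
    (hf : ∀ ρ : Measure X, IsFiniteMeasure ρ → Integrable f ρ) :
    signedIntegral f (μ.toSignedMeasure - ν.toSignedMeasure) =
      ∫ x, f x ∂μ - ∫ x, f x ∂ν :=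
  integral_sub_eq_of_toSignedMeasure_sub_eq (posPart_toSignedMeasure_sub_negPart _) hf

/-- A difference of signed measures as a difference of two finite measures. -/
theorem sub_eq_toSignedMeasure_sub (σ τ : SignedMeasure X) :
    σ - τ = (σ.toJordanDecomposition.posPart + τ.toJordanDecomposition.negPart).toSignedMeasure -
      (σ.toJordanDecomposition.negPart + τ.toJordanDecomposition.posPart).toSignedMeasure := by
  conv_lhs => rw [← posPart_toSignedMeasure_sub_negPart σ, ← posPart_toSignedMeasure_sub_negPart τ]
  rw [Measure.toSignedMeasure_add, Measure.toSignedMeasure_add]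
  abel

theorem signedIntegral_sub (σ τ : SignedMeasure X) {f : X → ℝ}
    (hf : ∀ ρ : Measure X, IsFiniteMeasure ρ → Integrable f ρ) :
    signedIntegral f (σ - τ) = signedIntegral f σ - signedIntegral f τ := by
  rw [sub_eq_toSignedMeasure_sub, signedIntegral_toSignedMeasure_sub _ _ hf, signedIntegral,
    signedIntegral, integral_add_measure (hf _ inferInstance) (hf _ inferInstance),
    integral_add_measure (hf _ inferInstance) (hf _ inferInstance)]
  ring

/-- The positive part is the truncated difference. This domination later passes tightness and mass
bounds to `μ n - ν`. -/
theorem posPart_toSignedMeasure_sub_le (μ ν : Measure X) [IsFiniteMeasure μ] [IsFiniteMeasure ν] :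
    (μ.toSignedMeasure - ν.toSignedMeasure).toJordanDecomposition.posPart ≤ μ := by
  rw [Measure.toJordanDecomposition_toSignedMeasure_sub,
    Measure.jordanDecompositionOfToSignedMeasureSub_posPart]
  exact Measure.sub_le

theorem negPart_toSignedMeasure_sub_le (μ ν : Measure X) [IsFiniteMeasure μ] [IsFiniteMeasure ν] :
    (μ.toSignedMeasure - ν.toSignedMeasure).toJordanDecomposition.negPart ≤ ν := by
  rw [Measure.toJordanDecomposition_toSignedMeasure_sub,
    Measure.jordanDecompositionOfToSignedMeasureSub_negPart]
  exact Measure.sub_le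

end SignedMeasure

theorem integrable_of_bounded_of_continuous {X : Type*} [TopologicalSpace X] [MeasurableSpace X]
    [OpensMeasurableSpace X] {f : X → ℝ} {M : ℝ} (hM : ∀ x, |f x| ≤ M) (hf : Continuous f)
    (ρ : Measure X) (_ : IsFiniteMeasure ρ) : Integrable f ρ :=
  .of_bound hf.measurable.aestronglyMeasurable M (.of_forall hM)

/-! ### The norm controls integrals of bounded Lipschitz functions. -/

section GenWasserstein

variable {d : ℕ}

theorem signedMass_toSignedMeasure_sub (μ ν : Measure (EuclideanSpace ℝ (Fin d)))
    [IsFiniteMeasure μ] [IsFiniteMeasure ν] :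
    signedMass (μ.toSignedMeasure - ν.toSignedMeasure) =
      (μ - ν) Set.univ + (ν - μ) Set.univ := by
  simp [signedMass, SignedMeasure.totalVariation,
    Measure.jordanDecompositionOfToSignedMeasureSub_posPart,
    Measure.jordanDecompositionOfToSignedMeasureSub_negPart]

theorem signedMass_toSignedMeasure_sub_of_le {μ ν : Measure (EuclideanSpace ℝ (Fin d))}
    [IsFiniteMeasure μ] [IsFiniteMeasure ν] (h : ν ≤ μ) :
    signedMass (μ.toSignedMeasure - ν.toSignedMeasure) = μ Set.univ - ν Set.univ := by
  rw [signedMass_toSignedMeasure_sub, Measure.sub_apply .univ h, Measure.sub_eq_zero_of_le h]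
  simp

/-- Transporting a part of each measure and cancelling the rest bounds the generalized
Wasserstein distance. -/
theorem genWasserstein_le_of_plan (a b : ℝ) {μ ν μ' ν' : Measure (EuclideanSpace ℝ (Fin d))}
    [IsFiniteMeasure μ] [IsFiniteMeasure ν] (hμ : μ' ≤ μ) (hν : ν' ≤ ν)
    {π : Measure (EuclideanSpace ℝ (Fin d) × EuclideanSpace ℝ (Fin d))}
    (hπ : π ∈ transferencePlans μ' ν') :
    genWasserstein a b μ ν ≤
      ENNReal.ofReal a * ((μ Set.univ - μ' Set.univ) + (ν Set.univ - ν' Set.univ)) +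
        ENNReal.ofReal b * ∫⁻ z, edist z.1 z.2 ∂π := by
  have hμ'fin : IsFiniteMeasure μ' := isFiniteMeasure_of_le μ hμ
  have hν'fin : IsFiniteMeasure ν' := isFiniteMeasure_of_le ν hν
  have hmass : μ' Set.univ = ν' Set.univ := by
    rw [← hπ.1, ← hπ.2, Measure.map_apply measurable_fst .univ,
      Measure.map_apply measurable_snd .univ]
    simp
  refine (iInf_le _ (⟨μ', hμ'fin⟩ : FiniteMeasure _)).trans
    ((iInf_le _ (⟨ν', hν'fin⟩ : FiniteMeasure _)).trans
      ((iInf_le _ (by simp [FiniteMeasure.mass, hmass])).trans ?_))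
  simp only [FiniteMeasure.toMeasure_mk]
  rw [signedMass_toSignedMeasure_sub_of_le hμ, signedMass_toSignedMeasure_sub_of_le hν]
  gcongr
  exact iInf₂_le π hπ

theorem enorm_integral_sub_le_signedMass {a : ℝ} {f : EuclideanSpace ℝ (Fin d) → ℝ}
    (hfa : ∀ x, |f x| ≤ a) (hf : Continuous f) (μ ν : Measure (EuclideanSpace ℝ (Fin d)))
    [IsFiniteMeasure μ] [IsFiniteMeasure ν] :
    ‖∫ x, f x ∂μ - ∫ x, f x ∂ν‖ₑ ≤
      ENNReal.ofReal a * signedMass (μ.toSignedMeasure - ν.toSignedMeasure) := by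
  have key (ρ : Measure (EuclideanSpace ℝ (Fin d))) [IsFiniteMeasure ρ] :
      ‖∫ x, f x ∂ρ‖ₑ ≤ ENNReal.ofReal a * ρ Set.univ := by
    refine (enorm_integral_le_lintegral_enorm _).trans ?_
    refine (lintegral_mono (g := fun _ => ENNReal.ofReal a) fun x => ?_).trans_eq (by simp)
    rw [Real.enorm_eq_ofReal_abs]
    exact ENNReal.ofReal_le_ofReal (hfa x)
  rw [signedMass_toSignedMeasure_sub, integral_sub_eq_of_toSignedMeasure_sub_eq
    (Measure.sub_toSignedMeasure_eq_toSignedMeasure_sub (μ := μ) (ν := ν))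
    (integrable_of_bounded_of_continuous hfa hf), mul_add]
  exact enorm_sub_le.trans (add_le_add (key _) (key _))

theorem enorm_integral_sub_le_wasserstein1 {M : ℝ} {b : ℝ≥0} (hb : b ≠ 0)
    {f : EuclideanSpace ℝ (Fin d) → ℝ} (hM : ∀ x, |f x| ≤ M) (hf : LipschitzWith b f)
    (μ ν : Measure (EuclideanSpace ℝ (Fin d))) [IsFiniteMeasure μ] :
    ‖∫ x, f x ∂μ - ∫ x, f x ∂ν‖ₑ ≤ b * wasserstein1 μ ν := by
  have hb0 : (b : ℝ≥0∞) ≠ 0 := by simpa using hb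
  -- `b ≠ 0` matters: the infimum over an empty set of plans is `∞`, and `0 * ∞ = 0`.
  rw [wasserstein1, ENNReal.mul_iInf_of_ne hb0 ENNReal.coe_ne_top]
  refine le_iInf fun π => ?_
  rw [ENNReal.mul_iInf_of_ne hb0 ENNReal.coe_ne_top]
  refine le_iInf fun hπ => ?_
  have hπfin : IsFiniteMeasure π := by
    have : IsFiniteMeasure (π.map Prod.fst) := hπ.1 ▸ ‹IsFiniteMeasure μ›
    exact Measure.isFiniteMeasure_of_map measurable_fst.aemeasurable
  have hfm := hf.continuous.measurable
  have h1 := integrable_of_bounded_of_continuous (fun z : _ × EuclideanSpace ℝ (Fin d) => hM z.1)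
    (hf.continuous.comp continuous_fst) π hπfin
  have h2 := integrable_of_bounded_of_continuous (fun z : EuclideanSpace ℝ (Fin d) × _ => hM z.2)
    (hf.continuous.comp continuous_snd) π hπfin
  rw [← hπ.1, ← hπ.2, integral_map measurable_fst.aemeasurable hfm.aestronglyMeasurable,
    integral_map measurable_snd.aemeasurable hfm.aestronglyMeasurable,
    ← integral_sub h1 h2,
    ← lintegral_const_mul' _ _ ENNReal.coe_ne_top]
  refine (enorm_integral_le_lintegral_enorm _).trans (lintegral_mono fun z => ?_)
  rw [← edist_eq_enorm_sub]
  exact hf z.1 z.2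

/-- Integration of bounded Lipschitz functions is controlled by the generalized Wasserstein
distance. -/
theorem enorm_integral_sub_le_genWasserstein {a b : ℝ} (hb : 0 < b)
    {f : EuclideanSpace ℝ (Fin d) → ℝ}
    (hfa : ∀ x, |f x| ≤ a) (hfb : LipschitzWith b.toNNReal f)
    (μ ν : Measure (EuclideanSpace ℝ (Fin d))) [IsFiniteMeasure μ] [IsFiniteMeasure ν] :
    ‖∫ x, f x ∂μ - ∫ x, f x ∂ν‖ₑ ≤ genWasserstein a b μ ν := by
  refine le_iInf fun μ' => le_iInf fun ν' => le_iInf fun _ => ?_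
  have h1 := enorm_integral_sub_le_signedMass hfa hfb.continuous μ μ'
  have h2 := enorm_integral_sub_le_signedMass hfa hfb.continuous ν ν'
  have h3 := enorm_integral_sub_le_wasserstein1 (by simpa using hb) hfa hfb (μ' : Measure _) ν'
  -- Telescoping through `μ'` and `ν'`: the sup bound `a` pays for cancelled mass, the Lipschitz
  -- constant `b` for transport.
  calc ‖∫ x, f x ∂μ - ∫ x, f x ∂ν‖ₑ
      = ‖(∫ x, f x ∂μ - ∫ x, f x ∂(μ' : Measure _)) -
          (∫ x, f x ∂ν - ∫ x, f x ∂(ν' : Measure _)) +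
          (∫ x, f x ∂(μ' : Measure _) - ∫ x, f x ∂(ν' : Measure _))‖ₑ := by congr 1; ring
    _ ≤ _ := (enorm_add_le _ _).trans
      (add_le_add (enorm_sub_le.trans ((add_le_add h1 h2).trans_eq (mul_add _ _ _).symm)) h3)

theorem exists_abs_signedIntegral_le {a b : ℝ} (ha : 0 < a) (hb : 0 < b) {M : ℝ} {L : ℝ≥0}
    {f : EuclideanSpace ℝ (Fin d) → ℝ} (hM : ∀ x, |f x| ≤ M) (hf : LipschitzWith L f) :
    ∃ C : ℝ, 0 < C ∧ ∀ σ : SignedMeasure (EuclideanSpace ℝ (Fin d)),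
      |signedIntegral f σ| ≤ C * genWassersteinNorm a b σ := by
  have hM0 : 0 ≤ M := (abs_nonneg _).trans (hM 0)
  obtain ⟨C, hC, hCM, hCL⟩ : ∃ C : ℝ, 0 < C ∧ M ≤ C * a ∧ L ≤ C * b := by
    -- Dividing `f` by this `C` makes it bounded by `a` and `b`-Lipschitz; the `1` keeps `C`
    -- positive when `M = L = 0`.
    refine ⟨M / a + L / b + 1, by positivity, ?_, ?_⟩
    · have h : M / a * a = M := by field_simp
      have : 0 ≤ (L / b + 1) * a := by positivity
      linarith
    · have h : L / b * b = L := by field_simp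
      have : 0 ≤ (M / a + 1) * b := by positivity
      linarith
  refine ⟨C, hC, fun σ => ?_⟩
  have hga : ∀ x, |C⁻¹ * f x| ≤ a := fun x => by
    rw [abs_mul, abs_of_pos (inv_pos.2 hC), inv_mul_le_iff₀ hC]
    exact (hM x).trans hCM
  have hgb : LipschitzWith b.toNNReal fun x => C⁻¹ * f x := by
    refine LipschitzWith.of_dist_le_mul fun x y => ?_
    rw [Real.dist_eq, ← mul_sub, abs_mul, abs_of_pos (inv_pos.2 hC), inv_mul_le_iff₀ hC,
      Real.coe_toNNReal _ hb.le, ← mul_assoc]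
    exact (hf.dist_le_mul x y).trans (by gcongr)
  have h := enorm_integral_sub_le_genWasserstein hb hga hgb
    σ.toJordanDecomposition.posPart σ.toJordanDecomposition.negPart
  rw [integral_const_mul, integral_const_mul, ← mul_sub, Real.enorm_eq_ofReal_abs,
    ENNReal.ofReal_le_iff_le_toReal (genWasserstein_ne_top _ _ _ _), abs_mul,
    abs_of_pos (inv_pos.2 hC), inv_mul_le_iff₀ hC] at h
  exact h

theorem tendsto_signedIntegral_of_genWassersteinTendsto {a b : ℝ} (ha : 0 < a) (hb : 0 < b)
    {M : ℝ} {L : ℝ≥0} {f : EuclideanSpace ℝ (Fin d) → ℝ} (hM : ∀ x, |f x| ≤ M)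
    (hf : LipschitzWith L f) {μ : ℕ → SignedMeasure (EuclideanSpace ℝ (Fin d))}
    {ν : SignedMeasure (EuclideanSpace ℝ (Fin d))} (h : GenWassersteinTendsto a b μ ν) :
    Tendsto (fun n => signedIntegral f (μ n)) atTop (𝓝 (signedIntegral f ν)) := by
  obtain ⟨C, -, hCσ⟩ := exists_abs_signedIntegral_le ha hb hM hf
  rw [tendsto_iff_dist_tendsto_zero]
  refine squeeze_zero (fun _ => dist_nonneg) (fun n => ?_) (by simpa using h.const_mul C)
  rw [Real.dist_eq, ← signedIntegral_sub _ _
    (integrable_of_bounded_of_continuous hM hf.continuous)]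
  exact hCσ _

theorem cauchySeq_signedIntegral_of_isGenWassersteinCauchy {a b : ℝ} (ha : 0 < a) (hb : 0 < b)
    {M : ℝ} {L : ℝ≥0} {f : EuclideanSpace ℝ (Fin d) → ℝ} (hM : ∀ x, |f x| ≤ M)
    (hf : LipschitzWith L f) {μ : ℕ → SignedMeasure (EuclideanSpace ℝ (Fin d))}
    (h : IsGenWassersteinCauchy a b μ) : CauchySeq fun n => signedIntegral f (μ n) := by
  obtain ⟨C, hC, hCσ⟩ := exists_abs_signedIntegral_le ha hb hM hf
  refine Metric.cauchySeq_iff.2 fun ε hε => ?_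
  obtain ⟨N, hN⟩ := h (ε / C) (by positivity)
  refine ⟨N, fun m hm n hn => ?_⟩
  rw [Real.dist_eq, ← signedIntegral_sub _ _
    (integrable_of_bounded_of_continuous hM hf.continuous)]
  exact (hCσ _).trans_lt ((lt_div_iff₀' hC).1 (hN m hm n hn))

end GenWasserstein

/-! ### Weak compactness, test functions, and cells of small diameter. -/

section WeakConvergence

variable {X : Type*} [MetricSpace X] [MeasurableSpace X] [BorelSpace X]

/-- Prokhorov's theorem along an ultrafilter, for finite measures of bounded mass. -/
theorem exists_tendsto_of_tight_of_mass_le {ι : Type*} {ρ : ι → FiniteMeasure X}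
    (ht : ∀ ε : ℝ≥0∞, 0 < ε → ∃ K : Set X, IsCompact K ∧ ∀ i, (ρ i : Measure X) Kᶜ ≤ ε)
    {C : ℝ≥0} (hC : ∀ i, (ρ i).mass ≤ C) (U : Ultrafilter ι) :
    ∃ l : FiniteMeasure X, Tendsto ρ U (𝓝 l) := by
  obtain ⟨u, -, hu0, hu⟩ := exists_seq_strictAnti_tendsto (0 : ℝ≥0)
  choose K hK hKρ using fun n => ht (u n) (by simpa using hu0 n)
  have hc := isCompact_setOfPred_finiteMeasure_mass_le_compl_isCompact_le C hu hK
    (.inl inferInstance)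
  obtain ⟨l, -, hl⟩ := hc.ultrafilter_le_nhds (U.map ρ) (by
    rw [le_principal_iff, Ultrafilter.mem_coe, Ultrafilter.mem_map]
    refine Filter.univ_mem' fun i => ⟨hC i, fun n => ?_⟩
    rw [← ENNReal.coe_le_coe, FiniteMeasure.ennreal_coeFn_eq_coeFn_toMeasure]
    exact hKρ n i)
  exact ⟨l, hl⟩

/-- Finite measures are determined by the integrals of bounded Lipschitz functions. -/
theorem measure_ext_of_forall_lipschitz_integral_eq {μ ν : Measure X} [IsFiniteMeasure μ]
    [IsFiniteMeasure ν]
    (h : ∀ (f : X → ℝ) (L : ℝ≥0), (∀ x, |f x| ≤ 1) → LipschitzWith L f →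
      ∫ x, f x ∂μ = ∫ x, f x ∂ν) : μ = ν := by
  have hclosed : ∀ s : Set X, IsClosed s → μ.real s = ν.real s := fun s hs => by
    -- Thickened indicators of a closed set are admissible test functions converging to its
    -- indicator; closed sets form a generating π-system.
    have key (ρ : Measure X) [IsFiniteMeasure ρ] := tendsto_integral_thickenedIndicator_of_isClosed
      ρ hs (δs := fun n : ℕ => (1 : ℝ) / (n + 1)) (fun _ => by positivity)
      tendsto_one_div_add_atTop_nhds_zero_nat
    refine tendsto_nhds_unique (key μ) ((key ν).congr fun n => (h _ _ (fun x => ?_)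
      (lipschitzWith_thickenedIndicator (by positivity) s)).symm)
    exact (abs_of_nonneg (NNReal.coe_nonneg _)).trans_le
      (NNReal.coe_le_one.2 (thickenedIndicator_le_one _ s x))
  have hmeas : ∀ s : Set X, IsClosed s → μ s = ν s := fun s hs =>
    (ENNReal.toReal_eq_toReal_iff' (measure_ne_top _ _) (measure_ne_top _ _)).1 (hclosed s hs)
  refine ext_of_generate_finite _ ?_ isPiSystem_isClosed (fun s hs => hmeas s hs)
    (hmeas _ isClosed_univ)
  rw [BorelSpace.measurable_eq (α := X), borel_eq_generateFrom_isClosed]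

theorem tendsto_measure_univ_of_tendsto {ι : Type*} {F : Filter ι} {ρ : ι → FiniteMeasure X}
    {l : FiniteMeasure X} (h : Tendsto ρ F (𝓝 l)) :
    Tendsto (fun i => (ρ i : Measure X) Set.univ) F (𝓝 ((l : Measure X) Set.univ)) := by
  simpa only [← FiniteMeasure.ennreal_mass] using ENNReal.tendsto_coe.2 h.mass

/-- Lower semicontinuity of the mass of an open set under weak convergence. -/
theorem eventually_measure_le_add_of_isOpen {ι : Type*} {F : Filter ι} {ρ : ι → FiniteMeasure X}
    {l : FiniteMeasure X} (h : Tendsto ρ F (𝓝 l)) {G : Set X} (hG : IsOpen G) {η : ℝ≥0∞}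
    (hη : η ≠ 0) : ∀ᶠ i in F, (l : Measure X) G ≤ (ρ i : Measure X) G + η := by
  have hη2 : η / 2 ≠ 0 := by simpa using hη
  have h1 : ∀ᶠ i in F, (ρ i : Measure X) Gᶜ < (l : Measure X) Gᶜ + η / 2 :=
    eventually_lt_of_limsup_lt
      ((FiniteMeasure.limsup_measure_closed_le_of_tendsto h hG.isClosed_compl).trans_lt
        (ENNReal.lt_add_right (measure_ne_top _ _) hη2))
  have h2 : ∀ᶠ i in F, (l : Measure X) Set.univ ≤ (ρ i : Measure X) Set.univ + η / 2 := by
    filter_upwards [((tendsto_measure_univ_of_tendsto h).add_const (η / 2)).eventually_const_lt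
      (ENNReal.lt_add_right (measure_ne_top _ _) hη2)] with i hi using hi.le
  filter_upwards [h1, h2] with i hi1 hi2
  rw [← measure_add_measure_compl hG.measurableSet, ← measure_add_measure_compl hG.measurableSet]
    at hi2
  refine (ENNReal.add_le_add_iff_right (measure_ne_top (l : Measure X) Gᶜ)).1 (hi2.trans ?_)
  calc _ ≤ (ρ i : Measure X) G + ((l : Measure X) Gᶜ + η / 2) + η / 2 := by gcongr
    _ = (ρ i : Measure X) G + (η / 2 + η / 2) + (l : Measure X) Gᶜ := by ring
    _ = _ := by rw [ENNReal.add_halves]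

/-- A finite measure on a separable metric space is carried by a countable union of disjoint
open sets of small diameter. -/
theorem exists_disjoint_isOpen_edist_le [TopologicalSpace.SeparableSpace X] (μ : Measure X) [IsFiniteMeasure μ]
    {δ : ℝ≥0} (hδ : 0 < δ) :
    ∃ G : ℕ → Set X, (∀ k, IsOpen (G k)) ∧ Pairwise (Function.onFun Disjoint G) ∧
      (∀ k, ∀ x ∈ G k, ∀ y ∈ G k, edist x y ≤ δ) ∧ μ (⋃ k, G k)ᶜ = 0 := by
  cases isEmpty_or_nonempty X
  · exact ⟨fun _ => ∅, by simp, fun _ _ _ => by simp [Function.onFun], by simp,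
      by simp [Set.eq_empty_of_isEmpty]⟩
  obtain ⟨x, hx⟩ := TopologicalSpace.exists_dense_seq X
  have hδ4 : (δ : ℝ) / 4 < δ / 2 := by
    have : (0 : ℝ) < δ := hδ
    linarith
  -- Radii above `δ / 4` make the balls cover, by density of the centres; radii below `δ / 2` bound
  -- the diameters.
  choose r hr hrμ using fun k => exists_null_frontier_thickening μ {x k} hδ4
  simp only [Metric.thickening_singleton] at hrμ
  -- Removing closures rather than balls keeps the cells open, and loses only points of the null
  -- frontiers.
  refine ⟨fun k => Metric.ball (x k) (r k) \ ⋃ j ∈ Finset.range k, closure (Metric.ball (x j) (r j)),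
    fun k => Metric.isOpen_ball.sdiff ?_, ?_, ?_, ?_⟩
  · exact isClosed_biUnion_finset fun j _ => isClosed_closure
  · refine (pairwise_disjoint_on _).2 fun j k hjk => ?_
    refine Set.disjoint_left.2 fun y hy hy' => hy'.2 ?_
    exact Set.mem_biUnion (Finset.mem_coe.2 (Finset.mem_range.2 hjk)) (subset_closure hy.1)
  · intro k y hy z hz
    rw [edist_dist, ← ENNReal.ofReal_coe_nnreal]
    refine ENNReal.ofReal_le_ofReal ?_
    have h1 := Metric.mem_ball.1 hy.1
    have h2 := Metric.mem_ball.1 hz.1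
    have h3 := (hr k).2
    have h4 := dist_triangle_right y z (x k)
    linarith
  · refine measure_mono_null (t := ⋃ k, frontier (Metric.ball (x k) (r k))) ?_
      (measure_iUnion_null hrμ)
    intro y hy
    by_contra hyf
    simp only [Set.mem_iUnion, not_exists] at hyf
    refine hy ?_
    have hex : ∃ k, y ∈ Metric.ball (x k) (r k) := by
      obtain ⟨k, hk⟩ := hx.exists_dist_lt y (show (0 : ℝ) < δ / 4 by positivity)
      exact ⟨k, hk.trans (hr k).1⟩
    classical
    refine Set.mem_iUnion.2 ⟨Nat.find hex, Nat.find_spec hex, ?_⟩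
    simp only [Set.mem_iUnion, not_exists, Finset.mem_range]
    intro j hj hyj
    refine hyf j ⟨hyj, ?_⟩
    rw [Metric.isOpen_ball.interior_eq]
    exact Nat.find_min hex hj

end WeakConvergence

/-! ### Submeasures with prescribed mass on disjoint cells. -/

section Partition

/-- The part of mass `m i` of `α`, proportional to `α` on each `G i`. -/
noncomputable def sumCond {X : Type*} [MeasurableSpace X] (s : Finset ℕ) (G : ℕ → Set X)
    (m : ℕ → ℝ≥0∞) (α : Measure X) : Measure X :=
  ∑ i ∈ s, m i • ProbabilityTheory.cond α (G i)

variable {X : Type*} [MeasurableSpace X] {s : Finset ℕ} {G : ℕ → Set X} {m : ℕ → ℝ≥0∞}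
  {α : Measure X}

theorem mul_cond_univ [IsFiniteMeasure α] {i : ℕ} (hm : m i ≤ α (G i)) :
    m i * ProbabilityTheory.cond α (G i) Set.univ = m i := by
  rcases eq_or_ne (m i) 0 with h0 | h0
  · simp [h0]
  · have hα : α (G i) ≠ 0 := fun h => h0 (le_antisymm (hm.trans h.le) bot_le)
    have := ProbabilityTheory.cond_isProbabilityMeasure hα
    rw [measure_univ, mul_one]

theorem sumCond_univ [IsFiniteMeasure α] (hm : ∀ i ∈ s, m i ≤ α (G i)) :
    sumCond s G m α Set.univ = ∑ i ∈ s, m i := by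
  simp only [sumCond, Measure.finsetSum_apply, Measure.smul_apply, smul_eq_mul]
  exact Finset.sum_congr rfl fun i hi => mul_cond_univ (hm i hi)

/-- Each piece is `α` on `G i` scaled by `m i / α (G i) ≤ 1`, and the cells do not overlap. -/
theorem sumCond_le (hG : ∀ i, MeasurableSet (G i)) (hd : Pairwise (Function.onFun Disjoint G))
    (hm : ∀ i ∈ s, m i ≤ α (G i)) : sumCond s G m α ≤ α := by
  refine Measure.le_iff.2 fun A hA => ?_
  simp only [sumCond, Measure.finsetSum_apply, Measure.smul_apply, smul_eq_mul]
  calc _ ≤ ∑ i ∈ s, α (G i ∩ A) := Finset.sum_le_sum fun i hi => ?_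
    _ = α (⋃ i ∈ s, G i ∩ A) := (measure_biUnion_finset
        (fun i _ j _ hij => (hd hij).mono Set.inter_subset_left Set.inter_subset_left)
        fun i _ => (hG i).inter hA).symm
    _ ≤ α A := measure_mono (Set.iUnion₂_subset fun i _ => Set.inter_subset_right)
  rw [ProbabilityTheory.cond_apply (hG i), ← mul_assoc]
  refine mul_le_of_le_one_left bot_le ?_
  exact (mul_le_mul_left (hm i hi) _).trans (ENNReal.mul_inv_le_one _)

end Partition

/-! ### A common weak limit forces the generalized Wasserstein distance to zero. -/

section GenWasserstein

variable {d : ℕ}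

/-- Couple the mass `m i` inside `G i` by the product of the conditional measures, so that nothing
moves further than `δ`, and cancel all remaining mass. -/
theorem genWasserstein_le_of_disjoint (a b : ℝ) {s : Finset ℕ}
    {G : ℕ → Set (EuclideanSpace ℝ (Fin d))} {m : ℕ → ℝ≥0∞} {δ : ℝ≥0∞}
    (hG : ∀ i, MeasurableSet (G i)) (hd : Pairwise (Function.onFun Disjoint G))
    (hδ : ∀ i, ∀ x ∈ G i, ∀ y ∈ G i, edist x y ≤ δ)
    {μ ν : Measure (EuclideanSpace ℝ (Fin d))} [IsFiniteMeasure μ] [IsFiniteMeasure ν]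
    (hμ : ∀ i ∈ s, m i ≤ μ (G i)) (hν : ∀ i ∈ s, m i ≤ ν (G i)) :
    genWasserstein a b μ ν ≤
      ENNReal.ofReal a * ((μ Set.univ - ∑ i ∈ s, m i) + (ν Set.univ - ∑ i ∈ s, m i)) +
        ENNReal.ofReal b * (δ * ∑ i ∈ s, m i) := by
  have hπ : (∑ i ∈ s, m i • (ProbabilityTheory.cond μ (G i)).prod (ProbabilityTheory.cond ν (G i)))
      ∈ transferencePlans (sumCond s G m μ) (sumCond s G m ν) := by
    constructor
    · rw [Measure.map_finset_sum measurable_fst.aemeasurable]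
      refine Finset.sum_congr rfl fun i hi => ?_
      rw [Measure.map_smul, Measure.map_fst_prod, smul_smul, mul_cond_univ (hν i hi)]
    · rw [Measure.map_finset_sum measurable_snd.aemeasurable]
      refine Finset.sum_congr rfl fun i hi => ?_
      rw [Measure.map_smul, Measure.map_snd_prod, smul_smul, mul_cond_univ (hμ i hi)]
  refine (genWasserstein_le_of_plan a b (sumCond_le hG hd hμ) (sumCond_le hG hd hν) hπ).trans ?_
  rw [sumCond_univ hμ, sumCond_univ hν]
  gcongr
  rw [lintegral_finsetSum_measure, Finset.mul_sum]
  refine Finset.sum_le_sum fun i hi => ?_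
  rw [lintegral_smul_measure, smul_eq_mul]
  calc m i * ∫⁻ z, edist z.1 z.2
        ∂(ProbabilityTheory.cond μ (G i)).prod (ProbabilityTheory.cond ν (G i))
      ≤ m i * ∫⁻ _, δ ∂(ProbabilityTheory.cond μ (G i)).prod (ProbabilityTheory.cond ν (G i)) := by
        gcongr 1
        refine lintegral_mono_ae ?_
        have h1 := (ProbabilityTheory.ae_cond_mem (μ := μ) (hG i))
        have h2 := (ProbabilityTheory.ae_cond_mem (μ := ν) (hG i))
        filter_upwards [Measure.quasiMeasurePreserving_fst.ae h1,
          Measure.quasiMeasurePreserving_snd.ae h2] with z hz1 hz2 using hδ i _ hz1 _ hz2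
    _ = δ * m i := by
        rw [lintegral_const, ← Set.univ_prod_univ, Measure.prod_prod, mul_left_comm, ← mul_assoc,
          ← mul_assoc, mul_assoc δ, mul_cond_univ (hμ i hi), mul_assoc, mul_cond_univ (hν i hi)]

/-- Two families of finite measures with the same weak limit are asymptotically close for the
generalized Wasserstein distance. -/
theorem tendsto_genWasserstein_zero (a b : ℝ) {ι : Type*} {F : Filter ι}
    {μ ν : ι → FiniteMeasure (EuclideanSpace ℝ (Fin d))}
    {l : FiniteMeasure (EuclideanSpace ℝ (Fin d))}
    (hμ : Tendsto μ F (𝓝 l)) (hν : Tendsto ν F (𝓝 l)) :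
    Tendsto (fun i => genWasserstein a b (μ i : Measure (EuclideanSpace ℝ (Fin d))) (ν i)) F (𝓝 0) := by
  rw [ENNReal.tendsto_nhds_zero]
  intro ε hε
  set T := (l : Measure (EuclideanSpace ℝ (Fin d))) Set.univ
  have hT : T ≠ ∞ := measure_ne_top _ _
  -- The `6` is twice the `3 * δ` of mass left over in each measure; `T` bounds the transported
  -- mass.
  obtain ⟨δ, hδ0, hδ⟩ := ENNReal.exists_nnreal_pos_mul_lt
    (a := ENNReal.ofReal a * 6 + ENNReal.ofReal b * T) (b := ε)
    (ENNReal.add_ne_top.2 ⟨ENNReal.mul_ne_top ENNReal.ofReal_ne_top (by simp),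
      ENNReal.mul_ne_top ENNReal.ofReal_ne_top hT⟩) hε.ne'
  have hδ0' : (δ : ℝ≥0∞) ≠ 0 := by simpa using hδ0.ne'
  obtain ⟨G, hGo, hGd, hGδ, hGl⟩ := exists_disjoint_isOpen_edist_le
    (l : Measure (EuclideanSpace ℝ (Fin d))) hδ0
  have hsum : ∑' k, (l : Measure (EuclideanSpace ℝ (Fin d))) (G k) = T := by
    rw [← measure_iUnion hGd fun k => (hGo k).measurableSet]
    exact measure_of_measure_compl_eq_zero hGl
  obtain ⟨N, hN⟩ : ∃ N : ℕ, T ≤ ∑ k ∈ Finset.range N,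
      (l : Measure (EuclideanSpace ℝ (Fin d))) (G k) + δ := by
    have h := (ENNReal.tendsto_nat_tsum fun k =>
      (l : Measure (EuclideanSpace ℝ (Fin d))) (G k)).add_const (δ : ℝ≥0∞)
    rw [hsum] at h
    obtain ⟨N, hN⟩ := (h.eventually_const_lt (ENNReal.lt_add_right hT hδ0')).exists
    exact ⟨N, hN.le⟩
  set η : ℝ≥0∞ := δ / (N + 1)
  have hη : η ≠ 0 := ENNReal.div_ne_zero.2 ⟨hδ0', by finiteness⟩
  -- By lower semicontinuity on open sets, both families eventually have this much mass in `G k`;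
  -- the `N` losses `η` total at most `δ`.
  set m : ℕ → ℝ≥0∞ := fun k => (l : Measure (EuclideanSpace ℝ (Fin d))) (G k) - η
  have hmT : ∑ k ∈ Finset.range N, m k ≤ T :=
    (Finset.sum_le_sum fun k _ => tsub_le_self).trans
      ((ENNReal.sum_le_tsum _).trans hsum.le)
  have hTm : T ≤ ∑ k ∈ Finset.range N, m k + (δ + δ) := by
    refine hN.trans ?_
    rw [← add_assoc]
    gcongr
    calc ∑ k ∈ Finset.range N, (l : Measure (EuclideanSpace ℝ (Fin d))) (G k)
        ≤ ∑ k ∈ Finset.range N, (m k + η) := Finset.sum_le_sum fun k _ => le_tsub_add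
      _ = ∑ k ∈ Finset.range N, m k + N * η := by simp [Finset.sum_add_distrib]
      _ ≤ _ := by
        gcongr
        refine (mul_le_mul_left (le_self_add (a := (N : ℝ≥0∞)) (b := 1)) η).trans ?_
        exact ENNReal.mul_div_le
  have key {ρ : ι → FiniteMeasure (EuclideanSpace ℝ (Fin d))} (hρ : Tendsto ρ F (𝓝 l)) :
      ∀ᶠ i in F, (∀ k ∈ Finset.range N, m k ≤ (ρ i : Measure (EuclideanSpace ℝ (Fin d))) (G k)) ∧
        (ρ i : Measure (EuclideanSpace ℝ (Fin d))) Set.univ - ∑ k ∈ Finset.range N, m k ≤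
          3 * δ := by
    -- The three `δ`: excess of total mass over `T`, cells beyond `N`, and the losses `η`.
    have h1 : ∀ᶠ i in F, (ρ i : Measure (EuclideanSpace ℝ (Fin d))) Set.univ < T + δ :=
      (tendsto_measure_univ_of_tendsto hρ).eventually_lt_const (ENNReal.lt_add_right hT hδ0')
    have h2 := (Finset.range N).eventually_all.2 fun k _ =>
      eventually_measure_le_add_of_isOpen hρ (hGo k) hη
    filter_upwards [h1, h2] with i hi1 hi2
    refine ⟨fun k hk => tsub_le_iff_right.2 (hi2 k hk), tsub_le_iff_left.2 ?_⟩
    calc _ ≤ T + δ := hi1.le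
      _ ≤ ∑ k ∈ Finset.range N, m k + (δ + δ) + δ := by gcongr
      _ = _ := by ring
  filter_upwards [key hμ, key hν] with i hi1 hi2
  refine (genWasserstein_le_of_disjoint a b (fun k => (hGo k).measurableSet) hGd hGδ hi1.1
    hi2.1).trans (le_trans ?_ hδ.le)
  calc _ ≤ ENNReal.ofReal a * (3 * δ + 3 * δ) + ENNReal.ofReal b * (δ * T) := by
        gcongr
        exacts [hi1.2, hi2.2]
    _ = _ := by ring

end GenWasserstein

/-! ### Convergence of tight Cauchy sequences of bounded mass. -/

section Completeness

variable {d : ℕ}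

/-- The positive part of the Jordan decomposition of a signed measure, as a finite measure. -/
noncomputable def posPartFinite {X : Type*} [MeasurableSpace X] (σ : SignedMeasure X) :
    FiniteMeasure X :=
  ⟨σ.toJordanDecomposition.posPart, inferInstance⟩

/-- The negative part of the Jordan decomposition of a signed measure, as a finite measure. -/
noncomputable def negPartFinite {X : Type*} [MeasurableSpace X] (σ : SignedMeasure X) :
    FiniteMeasure X :=
  ⟨σ.toJordanDecomposition.negPart, inferInstance⟩

/-- A family dominated by the sum of a tight family of bounded mass and a fixed measure has a weak
limit along every ultrafilter. -/
theorem exists_tendsto_of_le_add {X : Type*} [MetricSpace X] [MeasurableSpace X] [BorelSpace X]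
    [CompleteSpace X] [SecondCountableTopology X] {ρ : ℕ → FiniteMeasure X} {τ : ℕ → Measure X}
    (ht : IsTightMeasureSet (Set.range τ)) {C : ℝ≥0} (hC : ∀ n, τ n Set.univ ≤ C)
    (κ : FiniteMeasure X) (h : ∀ n, (ρ n : Measure X) ≤ τ n + (κ : Measure X))
    (U : Ultrafilter ℕ) : ∃ l : FiniteMeasure X, Tendsto ρ U (𝓝 l) := by
  refine exists_tendsto_of_tight_of_mass_le (C := C + κ.mass) (fun ε hε => ?_) (fun n => ?_) U
  · have hε2 : 0 < ε / 2 := ENNReal.half_pos hε.ne'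
    obtain ⟨K₁, hK₁, hτ⟩ :=
      isTightMeasureSet_iff_exists_isCompact_measure_compl_le.1 ht (ε / 2) hε2
    obtain ⟨K₂, hK₂, hκ⟩ := isTightMeasureSet_iff_exists_isCompact_measure_compl_le.1
      (isTightMeasureSet_singleton (μ := (κ : Measure X))) (ε / 2) hε2
    refine ⟨K₁ ∪ K₂, hK₁.union hK₂, fun n => ?_⟩
    calc (ρ n : Measure X) (K₁ ∪ K₂)ᶜ ≤ τ n (K₁ ∪ K₂)ᶜ + (κ : Measure X) (K₁ ∪ K₂)ᶜ := h n _
      _ ≤ ε / 2 + ε / 2 := by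
        gcongr
        · exact (measure_mono (Set.compl_subset_compl.2 Set.subset_union_left)).trans
            (hτ _ ⟨n, rfl⟩)
        · exact (measure_mono (Set.compl_subset_compl.2 Set.subset_union_right)).trans
            (hκ _ rfl)
      _ = ε := ENNReal.add_halves ε
  · rw [← ENNReal.coe_le_coe, ENNReal.coe_add, FiniteMeasure.ennreal_mass,
      FiniteMeasure.ennreal_mass]
    exact (h n Set.univ).trans (add_le_add_left (hC n) _)

/-- A Cauchy sequence of signed measures that is tight and of bounded mass converges. -/
theorem exists_genWassersteinTendsto_of_tight {a b : ℝ} (ha : 0 < a) (hb : 0 < b)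
    {μ : ℕ → SignedMeasure (EuclideanSpace ℝ (Fin d))} (hμ : IsGenWassersteinCauchy a b μ)
    (ht : IsTightSignedSeq μ) (hC : HasBoundedMass μ) :
    ∃ ν : SignedMeasure (EuclideanSpace ℝ (Fin d)), GenWassersteinTendsto a b μ ν := by
  obtain ⟨C, hC⟩ := hC
  have hCp : ∀ n, (μ n).toJordanDecomposition.posPart Set.univ ≤ C := fun n =>
    (le_self_add (b := (μ n).toJordanDecomposition.negPart Set.univ)).trans (hC n)
  have hCn : ∀ n, (μ n).toJordanDecomposition.negPart Set.univ ≤ C := fun n =>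
    (le_add_self (b := (μ n).toJordanDecomposition.posPart Set.univ)).trans (hC n)
  obtain ⟨α, hα⟩ := exists_tendsto_of_le_add (ρ := fun n => posPartFinite (μ n)) ht.1 hCp 0
    (fun n => by simp [posPartFinite]) (hyperfilter ℕ)
  obtain ⟨β, hβ⟩ := exists_tendsto_of_le_add (ρ := fun n => negPartFinite (μ n)) ht.2 hCn 0
    (fun n => by simp [negPartFinite]) (hyperfilter ℕ)
  set ν := (α : Measure (EuclideanSpace ℝ (Fin d))).toSignedMeasure -
    (β : Measure (EuclideanSpace ℝ (Fin d))).toSignedMeasure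
  have hνμ (n : ℕ) : μ n - ν =
      ((μ n).toJordanDecomposition.posPart + (β : Measure _)).toSignedMeasure -
        ((μ n).toJordanDecomposition.negPart + (α : Measure _)).toSignedMeasure := by
    conv_lhs => rw [← posPart_toSignedMeasure_sub_negPart (μ n)]
    simp only [ν]
    rw [Measure.toSignedMeasure_add, Measure.toSignedMeasure_add]
    abel
  have tendsto_integral {F : Filter ℕ} {ρ : ℕ → FiniteMeasure (EuclideanSpace ℝ (Fin d))}
      {l : FiniteMeasure (EuclideanSpace ℝ (Fin d))} (h : Tendsto ρ F (𝓝 l))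
      {f : EuclideanSpace ℝ (Fin d) → ℝ} (hf1 : ∀ x, |f x| ≤ 1) (hf : Continuous f) :
      Tendsto (fun n => ∫ x, f x ∂(ρ n : Measure _)) F (𝓝 (∫ x, f x ∂(l : Measure _))) :=
    FiniteMeasure.tendsto_iff_forall_integral_tendsto.1 h
      (BoundedContinuousFunction.ofNormedAddCommGroup f hf 1 hf1)
  have hlim {f : EuclideanSpace ℝ (Fin d) → ℝ} {L : ℝ≥0} (hf1 : ∀ x, |f x| ≤ 1)
      (hf : LipschitzWith L f) :
      Tendsto (fun n => signedIntegral f (μ n - ν)) atTop (𝓝 0) := by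
    have hfi := integrable_of_bounded_of_continuous hf1 hf.continuous
    obtain ⟨y, hy⟩ := cauchySeq_tendsto_of_complete
      (cauchySeq_signedIntegral_of_isGenWassersteinCauchy ha hb hf1 hf hμ)
    -- The Cauchy property gives a limit along `atTop`; the ultrafilter defining `α` and `β`
    -- identifies it.
    have hyν : y = signedIntegral f ν := by
      refine tendsto_nhds_unique (hy.mono_left Nat.hyperfilter_le_atTop) ?_
      rw [signedIntegral_toSignedMeasure_sub _ _ hfi]
      exact (tendsto_integral hα hf1 hf.continuous).sub (tendsto_integral hβ hf1 hf.continuous)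
    simp only [signedIntegral_sub _ _ hfi]
    simpa [hyν] using hy.sub_const (signedIntegral f ν)
  -- `V` is arbitrary below `atTop`, unrelated to the ultrafilter that produced `ν`; `hlim` holds
  -- along it too.
  refine ⟨ν, (tendsto_iff_ultrafilter _ _ _).2 fun V hV => ?_⟩
  obtain ⟨l, hl⟩ := exists_tendsto_of_le_add (ρ := fun n => posPartFinite (μ n - ν)) ht.1 hCp β
    (fun n => by
      simp only [posPartFinite, hνμ, FiniteMeasure.toMeasure_mk]
      exact posPart_toSignedMeasure_sub_le _ _) V
  obtain ⟨l', hl'⟩ := exists_tendsto_of_le_add (ρ := fun n => negPartFinite (μ n - ν)) ht.2 hCn α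
    (fun n => by
      simp only [negPartFinite, hνμ, FiniteMeasure.toMeasure_mk]
      exact negPart_toSignedMeasure_sub_le _ _) V
  have hll' : (l : Measure (EuclideanSpace ℝ (Fin d))) = l' :=
    measure_ext_of_forall_lipschitz_integral_eq fun f L hf1 hf => by
      have h1 := (tendsto_integral hl hf1 hf.continuous).sub
        (tendsto_integral hl' hf1 hf.continuous)
      exact sub_eq_zero.1 (tendsto_nhds_unique h1 ((hlim hf1 hf).mono_left hV))
  obtain rfl : l = l' := Subtype.ext hll'
  have h0 := (ENNReal.tendsto_toReal ENNReal.zero_ne_top).comp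
    (tendsto_genWasserstein_zero a b hl hl')
  exact h0

end Completeness

/-! ### Escaping dipoles: a Cauchy sequence without a limit. -/

section Incompleteness

variable {d : ℕ}

/-- The finite set of points `p k` separates the two sums. They are thus the Jordan parts of their
difference, on which the norm is defined. -/
theorem mutuallySingular_sum_dirac {X : Type*} [MeasurableSpace X] [MeasurableSingletonClass X]
    {p q : ℕ → X} (hpq : ∀ i j, p i ≠ q j) (s : Finset ℕ) :
    (∑ k ∈ s, Measure.dirac (p k)).MutuallySingular (∑ k ∈ s, Measure.dirac (q k)) := by
  have hm : MeasurableSet (p '' s) := (s.finite_toSet.image p).measurableSet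
  refine ⟨(p '' s)ᶜ, hm.compl, ?_, ?_⟩
  · rw [Measure.finsetSum_apply]
    refine Finset.sum_eq_zero fun k hk => ?_
    rw [Measure.dirac_apply' _ hm.compl, Set.indicator_of_notMem]
    exact fun h => h ⟨k, hk, rfl⟩
  · rw [Measure.finsetSum_apply, compl_compl]
    refine Finset.sum_eq_zero fun k hk => ?_
    rw [Measure.dirac_apply' _ hm, Set.indicator_of_notMem]
    rintro ⟨j, -, hj⟩
    exact hpq j k hj

/-- Send each `p k` to `q k` and cancel nothing. -/
theorem genWassersteinNorm_sum_dirac_sub_le {a b : ℝ} (hb : 0 ≤ b)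
    {p q : ℕ → EuclideanSpace ℝ (Fin d)} (hpq : ∀ i j, p i ≠ q j) (s : Finset ℕ) :
    genWassersteinNorm a b ((∑ k ∈ s, Measure.dirac (p k)).toSignedMeasure -
      (∑ k ∈ s, Measure.dirac (q k)).toSignedMeasure) ≤ b * ∑ k ∈ s, dist (p k) (q k) := by
  set j : JordanDecomposition (EuclideanSpace ℝ (Fin d)) :=
    ⟨∑ k ∈ s, Measure.dirac (p k), ∑ k ∈ s, Measure.dirac (q k), mutuallySingular_sum_dirac hpq s⟩
  have hj : ((∑ k ∈ s, Measure.dirac (p k)).toSignedMeasure -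
      (∑ k ∈ s, Measure.dirac (q k)).toSignedMeasure).toJordanDecomposition = j :=
    SignedMeasure.toJordanDecomposition_eq rfl
  simp only [genWassersteinNorm, hj]
  have hπ : ∑ k ∈ s, Measure.dirac (p k, q k) ∈ transferencePlans j.posPart j.negPart := by
    constructor
    · rw [Measure.map_finset_sum measurable_fst.aemeasurable]
      exact Finset.sum_congr rfl fun k _ => Measure.map_dirac' measurable_fst _
    · rw [Measure.map_finset_sum measurable_snd.aemeasurable]
      exact Finset.sum_congr rfl fun k _ => Measure.map_dirac' measurable_snd _
  refine ENNReal.toReal_le_of_le_ofReal (by positivity)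
    ((genWasserstein_le_of_plan a b le_rfl le_rfl hπ).trans_eq ?_)
  rw [tsub_self, tsub_self, add_zero, mul_zero, zero_add, ENNReal.ofReal_mul hb,
    lintegral_finsetSum_measure, ENNReal.ofReal_sum_of_nonneg fun _ _ => dist_nonneg]
  simp [edist_dist]

/-- The partial sums of `∑ (δ_{p k} - δ_{q k})`. -/
noncomputable def diracDifferences (p q : ℕ → EuclideanSpace ℝ (Fin d)) (n : ℕ) :
    SignedMeasure (EuclideanSpace ℝ (Fin d)) :=
  (∑ k ∈ Finset.range n, Measure.dirac (p k)).toSignedMeasure -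
    (∑ k ∈ Finset.range n, Measure.dirac (q k)).toSignedMeasure

theorem diracDifferences_sub (p q : ℕ → EuclideanSpace ℝ (Fin d)) {n m : ℕ} (hnm : n ≤ m) :
    diracDifferences p q m - diracDifferences p q n =
      (∑ k ∈ Finset.Ico n m, Measure.dirac (p k)).toSignedMeasure -
        (∑ k ∈ Finset.Ico n m, Measure.dirac (q k)).toSignedMeasure := by
  have key (r : ℕ → EuclideanSpace ℝ (Fin d)) :
      (∑ k ∈ Finset.range m, Measure.dirac (r k)).toSignedMeasure =
        (∑ k ∈ Finset.range n, Measure.dirac (r k)).toSignedMeasure +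
          (∑ k ∈ Finset.Ico n m, Measure.dirac (r k)).toSignedMeasure := by
    rw [← Measure.toSignedMeasure_add]
    exact Measure.toSignedMeasure_congr (Finset.sum_range_add_sum_Ico _ hnm).symm
  rw [diracDifferences, diracDifferences, key p, key q]
  abel

theorem isGenWassersteinCauchy_diracDifferences {a b : ℝ} (hb : 0 < b)
    {p q : ℕ → EuclideanSpace ℝ (Fin d)} (hpq : ∀ i j, p i ≠ q j)
    (hs : Summable fun k => dist (p k) (q k)) :
    IsGenWassersteinCauchy a b (diracDifferences p q) := by
  intro ε hε
  obtain ⟨N, hN⟩ := summable_iff_vanishing_norm.1 hs (ε / b) (by positivity)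
  obtain ⟨M, hM⟩ := N.exists_nat_subset_range
  have key {n m : ℕ} (hn : M ≤ n) :
      b * ∑ k ∈ Finset.Ico n m, dist (p k) (q k) < ε := by
    refine (lt_div_iff₀' hb).1 ((le_abs_self _).trans_lt (hN _ ?_))
    refine Finset.disjoint_left.2 fun k hk hkN => ?_
    have h1 := (Finset.mem_Ico.1 hk).1
    have h2 := Finset.mem_range.1 (hM hkN)
    omega
  refine ⟨M, fun m hm n hn => ?_⟩
  rcases le_total n m with hnm | hnm
  · rw [diracDifferences_sub p q hnm]
    exact (genWassersteinNorm_sum_dirac_sub_le hb.le hpq _).trans_lt (key hn)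
  · rw [← neg_sub, diracDifferences_sub p q hnm, neg_sub]
    refine (genWassersteinNorm_sum_dirac_sub_le hb.le (fun i j => (hpq j i).symm) _).trans_lt ?_
    simpa only [dist_comm] using key hm

theorem signedIntegral_diracDifferences {f : EuclideanSpace ℝ (Fin d) → ℝ}
    (hf : ∀ ρ : Measure (EuclideanSpace ℝ (Fin d)), IsFiniteMeasure ρ → Integrable f ρ)
    (p q : ℕ → EuclideanSpace ℝ (Fin d)) (n : ℕ) :
    signedIntegral f (diracDifferences p q n) =
      ∑ k ∈ Finset.range n, f (p k) - ∑ k ∈ Finset.range n, f (q k) := by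
  rw [diracDifferences, signedIntegral_toSignedMeasure_sub _ _ hf,
    integral_finsetSum_measure fun _ _ => hf _ inferInstance,
    integral_finsetSum_measure fun _ _ => hf _ inferInstance]
  simp

/-- The tent function of height `1` and slope `c` at `x₀`. -/
noncomputable def tent {X : Type*} [PseudoMetricSpace X] (c : ℝ≥0) (x₀ x : X) : ℝ :=
  max 0 (1 - c * dist x x₀)

section Tent

variable {X : Type*} [PseudoMetricSpace X]

theorem lipschitzWith_tent (c : ℝ≥0) (x₀ : X) : LipschitzWith c (tent c x₀) := by
  refine LipschitzWith.const_max (LipschitzWith.of_dist_le_mul fun x y => ?_) 0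
  rw [Real.dist_eq, show 1 - c * dist x x₀ - (1 - c * dist y x₀) =
    c * (dist y x₀ - dist x x₀) by ring, abs_mul, abs_of_nonneg c.coe_nonneg, dist_comm x y]
  gcongr
  exact abs_dist_sub_le _ _ _

theorem abs_tent_le (c : ℝ≥0) (x₀ x : X) : |tent c x₀ x| ≤ 1 := by
  have : 0 ≤ c * dist x x₀ := by positivity
  rw [tent, abs_of_nonneg (le_max_left _ _)]
  exact max_le zero_le_one (by linarith)

theorem tent_self (c : ℝ≥0) (x₀ : X) : tent c x₀ x₀ = 1 := by simp [tent]

theorem tent_eq_zero {c : ℝ≥0} {x₀ x : X} (h : 1 ≤ c * dist x x₀) : tent c x₀ x = 0 :=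
  max_eq_left (by linarith)

end Tent

/-- Moving unit masses at `k e` by `2^{-(k+1)}`, for all `k`, gives a Cauchy sequence of signed
measures without a limit. -/
theorem exists_isGenWassersteinCauchy_not_tendsto {a b : ℝ} (ha : 0 < a) (hb : 0 < b)
    (hd : 1 ≤ d) :
    ∃ μ : ℕ → SignedMeasure (EuclideanSpace ℝ (Fin d)), IsGenWassersteinCauchy a b μ ∧
      ∀ ν : SignedMeasure (EuclideanSpace ℝ (Fin d)), ¬ GenWassersteinTendsto a b μ ν := by
  have : Nontrivial (EuclideanSpace ℝ (Fin d)) := by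
    have : Nonempty (Fin d) := ⟨⟨0, hd⟩⟩
    infer_instance
  obtain ⟨e, he⟩ := exists_norm_eq (EuclideanSpace ℝ (Fin d)) zero_le_one
  have hdist (s t : ℝ) : dist (s • e) (t • e) = |s - t| := by
    rw [dist_eq_norm, ← sub_smul, norm_smul, he, mul_one, Real.norm_eq_abs]
  set r : ℕ → ℝ := fun k => (1 / 2) ^ (k + 1)
  have hr0 (k : ℕ) : 0 < r k := by positivity
  have hr (k : ℕ) : r k ≤ 1 / 2 :=
    (pow_le_pow_of_le_one (by norm_num) (by norm_num) (Nat.le_add_left 1 k)).trans_eq (pow_one _)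
  set q : ℕ → EuclideanSpace ℝ (Fin d) := fun k => (k : ℝ) • e
  set p : ℕ → EuclideanSpace ℝ (Fin d) := fun k => (k + r k : ℝ) • e
  -- The slope is the inverse of `r k`, so the tent at `p k` vanishes at distance `r k` and beyond,
  -- hence at every `q j` and every other `p j`.
  set c : ℕ → ℝ≥0 := fun k => 2 ^ (k + 1)
  have hcr (k : ℕ) : (c k : ℝ) * r k = 1 := by
    simp only [c, r, NNReal.coe_pow, NNReal.coe_ofNat, ← mul_pow]
    norm_num
  have hcle {k : ℕ} {t : ℝ} (ht : r k ≤ t) : 1 ≤ c k * t := by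
    rw [← hcr k]
    gcongr
  have hgap {j k : ℕ} (hjk : j ≠ k) : (j : ℝ) + 1 ≤ k ∨ (k : ℝ) + 1 ≤ j := by
    rcases lt_or_gt_of_ne hjk with h | h
    · exact .inl (by exact_mod_cast h)
    · exact .inr (by exact_mod_cast h)
  have hqp (j k : ℕ) : r k ≤ dist (q j) (p k) := by
    rw [hdist]
    have h1 := hr k
    have h2 := hr0 k
    rcases eq_or_ne j k with rfl | hjk
    · rw [sub_add_cancel_left, abs_neg, abs_of_pos h2]
    · rcases hgap hjk with h | h
      · exact le_abs.2 (.inr (by linarith))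
      · exact le_abs.2 (.inl (by linarith))
  have hpp {j k : ℕ} (hjk : j ≠ k) : r k ≤ dist (p j) (p k) := by
    rw [hdist]
    have h1 := hr k
    have h2 := hr0 k
    have h3 := hr j
    have h4 := hr0 j
    rcases hgap hjk with h | h
    · exact le_abs.2 (.inr (by linarith))
    · exact le_abs.2 (.inl (by linarith))
  have hsum : Summable fun k => dist (p k) (q k) := by
    simp only [p, q, hdist, add_sub_cancel_left, abs_of_pos (hr0 _)]
    exact (summable_nat_add_iff 1).2 (summable_geometric_of_lt_one (by norm_num) (by norm_num))
  refine ⟨diracDifferences p q, isGenWassersteinCauchy_diracDifferences hb (fun i j h => ?_) hsum,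
    fun ν hν => ?_⟩
  · have := hqp j i
    rw [h, dist_self] at this
    exact (hr0 i).not_ge this
  -- Here `k` is fixed while `n` grows, so it does not matter that the slopes `c k` are unbounded.
  have hone (k : ℕ) : signedIntegral (tent (c k) (p k)) ν = 1 := by
    refine tendsto_nhds_unique (tendsto_signedIntegral_of_genWassersteinTendsto ha hb
      (abs_tent_le (c k) (p k)) (lipschitzWith_tent _ _) hν) (tendsto_const_nhds.congr' ?_)
    filter_upwards [eventually_gt_atTop k] with n hn
    rw [signedIntegral_diracDifferences (integrable_of_bounded_of_continuous
      (abs_tent_le (c k) (p k)) (lipschitzWith_tent _ _).continuous),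
      Finset.sum_eq_single_of_mem k (Finset.mem_range.2 hn)
        (fun j _ hjk => tent_eq_zero (hcle (hpp hjk))),
      Finset.sum_eq_zero fun j _ => tent_eq_zero (hcle (hqp j k)), tent_self, sub_zero]
  have hzero (ρ : Measure (EuclideanSpace ℝ (Fin d))) [IsFiniteMeasure ρ] :
      Tendsto (fun k => ∫ x, tent (c k) (p k) x ∂ρ) atTop (𝓝 0) := by
    rw [← integral_zero (EuclideanSpace ℝ (Fin d)) ℝ (μ := ρ)]
    refine tendsto_integral_of_dominated_convergence (fun _ => 1)
      (fun k => (lipschitzWith_tent _ _).continuous.measurable.aestronglyMeasurable)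
      (integrable_const 1) (fun k => .of_forall fun x => abs_tent_le _ _ x)
      (.of_forall fun x => tendsto_const_nhds.congr' ?_)
    -- From this `k` on, `p k` is at distance at least `1 ≥ r k` from `x`.
    filter_upwards [eventually_ge_atTop ⌈‖x‖ + 1⌉₊] with k hk
    refine (tent_eq_zero (hcle ?_)).symm
    have h1 : ‖x‖ + 1 ≤ k := Nat.ceil_le.1 hk
    have h2 : ‖p k‖ = k + r k := by
      rw [norm_smul, he, mul_one, Real.norm_of_nonneg (add_nonneg k.cast_nonneg (hr0 k).le)]
    have h3 := norm_sub_norm_le (p k) x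
    rw [dist_comm, dist_eq_norm]
    linarith [hr k]
  have h := (hzero ν.toJordanDecomposition.posPart).sub (hzero ν.toJordanDecomposition.negPart)
  have h1 := tendsto_nhds_unique h (tendsto_const_nhds.congr fun k => (hone k).symm)
  norm_num at h1

end Incompleteness

theorem theorem29 (d : ℕ) (a b : ℝ) (ha : 0 < a) (hb : 0 < b) :
    (1 ≤ d → ¬ ∀ μ : ℕ → SignedMeasure (EuclideanSpace ℝ (Fin d)),
      IsGenWassersteinCauchy a b μ →
        ∃ ν : SignedMeasure (EuclideanSpace ℝ (Fin d)), GenWassersteinTendsto a b μ ν) ∧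
    (∀ μ : ℕ → SignedMeasure (EuclideanSpace ℝ (Fin d)),
      IsGenWassersteinCauchy a b μ → IsTightSignedSeq μ → HasBoundedMass μ →
        ∃ ν : SignedMeasure (EuclideanSpace ℝ (Fin d)), GenWassersteinTendsto a b μ ν) := by
  refine ⟨fun hd h => ?_, fun μ => exists_genWassersteinTendsto_of_tight ha hb⟩
  obtain ⟨μ, hμ, hν⟩ := exists_isGenWassersteinCauchy_not_tendsto ha hb hd
  obtain ⟨ν, h⟩ := h μ hμ
  exact hν ν h
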